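/- A game structure is a finite directed graph without deadlock whose vertex set $V$ is partitioned into the vertices of player 1 and those of player 2; a play is an infinite path. A strategy of player $i$ maps every $\rho v\in V^*V_i$ to a successor of $v$; it is encoded by a Moore machine $(M,m_0,\alpha_u,\alpha_n)$, with update function $\alpha_u\colon M\times V\to M$ and next-action function $\alpha_n\colon M\times V_i\to V$, if $\sigma(\rho v)=\alpha_n(\hat\alpha_u(m_0,\rho),v)$ for all $\rho v$, and its size is then $|M|$. For priorities write $c\preceq c'$ if $c$ is even and $c\le c'$. For $p\colon V\to\mathbb N$ and $\lambda\geq 1$, $\mathsf{DirFixPR}(\lambda,p)$ is the set of plays $\pi$ such that for all $j\ge 0$ there is $l<\lambda$ with $p(\pi[j+l])\preceq p(\pi[j])$, and $\mathsf{DirFixWP}(\lambda,p)$ the set of plays $\pi$ such that for all $j\ge0$ there is $l<\lambda$ with $p(\pi[j+l])\preceq p(\pi[j+k])$ for all $k\le l$. For $\mathsf X\in\{\mathsf{PR},\mathsf{WP}\}$, $\mathsf{FixX}(\lambda,p)$ is the set of plays with a suffix in $\mathsf{DirFixX}(\lambda,p)$, $\mathsf{DirBndX}(p)$ is the union of the sets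 $\mathsf{DirFixX}(\lambda,p)$ over $\lambda\ge1$, and $\mathsf{BndX}(p)$ is the set of plays with a suffix in $\mathsf{DirBndX}(p)$. Given priority functions $p_1,\dots,p_n$ and one of these eight types, the objective of player 1 is the intersection $\Omega=\bigcap_{m=1}^n\Omega_m$ of the objectives of that type for $p_1,\dots,p_n$ (with the same $\lambda$ for the fixed types); player 2 has the complementary objective. Statement: for each of the eight types, both players need exponential memory to win, even if all priorities are in $\{0,1,2\}$. Precisely, for each player $i\in\{1,2\}$ there is a constant $C$ such that for every $k\in\mathbb N$ there are a game structure with $|V|\le C(k+1)$, an initial vertex $v_0$, a number of dimensions $1\le n\le C(k+1)$, priority functions $p_1,\dots,p_n\colon V\to\{0,1,2\}$ and a bound $1\le\lambda\le C(k+1)$ such that, for each of the eight types of objectives, player $i$ has a winning strategy from $v_0$, and every winning strategy from $v_0$ of player $i$ that is encoded by a finite Moore machine has size at least $2^k$. Moreover, for player 1 and every type, and for player 2 and every type other than $\mathsf{BndPR}$ and $\mathsf{BndWP}$, player $i$ does have a winning strategy from $v_0$ of finite size in these games. (For player 2 and the two types $\mathsf{BndPR}$, $\mathsf{BndWP}$,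 there may be only infinite-memory winning strategies.) -/

import Mathlib

namespace WindowParity

/-- The two players. -/
inductive Player where
  | one
  | two

/-- A turn-based game structure on the vertex set `V` (which is finite wherever it is used):
each vertex is controlled by exactly one player, and there is no deadlock. -/
structure GameStructure (V : Type*) where
  owner : V → Player
  E : V → V → Prop
  no_deadlock : ∀ v, ∃ v', E v v'

variable {V : Type*}

/-- The plays: infinite paths. -/
def GameStructure.plays (G : GameStructure V) : Set (ℕ → V) :=
  {π | ∀ k, G.E (π k) (π (k + 1))}

/-- A strategy of player `i`: to each `ρ v` with `ρ ∈ V*` and `v` a vertex of player `i`, it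
assigns a successor of `v`. -/
structure Strategy (G : GameStructure V) (i : Player) where
  move : List V → {v : V // G.owner v = i} → V
  legal : ∀ ρ v, G.E v.1 (move ρ v)

/-- One step of the game: the vertex that follows `ρ v` when the players use `σ₁` and `σ₂`. -/
def GameStructure.next (G : GameStructure V) (σ₁ : Strategy G .one) (σ₂ : Strategy G .two)
    (ρ : List V) (v : V) : V :=
  match h : G.owner v with
  | .one => σ₁.move ρ ⟨v, h⟩
  | .two => σ₂.move ρ ⟨v, h⟩

/-- The history of length `k` of the outcome, as the pair (strict prefix, last vertex). -/
def GameStructure.outcomeHistory (G : GameStructure V) (v₀ : V) (σ₁ : Strategy G .one)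
    (σ₂ : Strategy G .two) : ℕ → List V × V
  | 0 => ([], v₀)
  | k + 1 =>
    let h := G.outcomeHistory v₀ σ₁ σ₂ k
    (h.1 ++ [h.2], G.next σ₁ σ₂ h.1 h.2)

/-- The outcome: the unique play from `v₀` that is consistent with both strategies. -/
def GameStructure.outcome (G : GameStructure V) (v₀ : V) (σ₁ : Strategy G .one)
    (σ₂ : Strategy G .two) : ℕ → V :=
  fun k => (G.outcomeHistory v₀ σ₁ σ₂ k).2

/-- A strategy is winning from `v₀` for the game with objective `Ω` (of player one): against
every strategy of the opponent, the outcome is in `Ω` for player one, and it is a play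
outside `Ω` for player two. -/
def Strategy.IsWinning {G : GameStructure V} :
    {i : Player} → Strategy G i → Set (ℕ → V) → V → Prop
  | .one, σ₁, Ω, v₀ => ∀ σ₂ : Strategy G .two, G.outcome v₀ σ₁ σ₂ ∈ Ω
  | .two, σ₂, Ω, v₀ => ∀ σ₁ : Strategy G .one, G.outcome v₀ σ₁ σ₂ ∈ G.plays \ Ω

/-- A deterministic Moore machine with memory `M` for player `i`. -/
structure MooreMachine (G : GameStructure V) (i : Player) (M : Type*) where
  init : M
  update : M → V → M
  action : M → {v : V // G.owner v = i} → V

/-- The machine encodes the strategy `σ`: `σ (ρ v) = action (update* init ρ) v`. -/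
def MooreMachine.Encodes {G : GameStructure V} {i : Player} {M : Type*}
    (A : MooreMachine G i M) (σ : Strategy G i) : Prop :=
  ∀ ρ v, σ.move ρ v = A.action (ρ.foldl A.update A.init) v

/-- Player `i` has a winning strategy from `v₀`. -/
def GameStructure.Wins (G : GameStructure V) (i : Player) (Ω : Set (ℕ → V)) (v₀ : V) : Prop :=
  ∃ σ : Strategy G i, σ.IsWinning Ω v₀

/-- Player `i` has a winning strategy from `v₀` that is encoded by a finite Moore machine with
exactly `s` memory states. -/
def GameStructure.WinsWithMemory (G : GameStructure V) (i : Player) (Ω : Set (ℕ → V)) (v₀ : V)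
    (s : ℕ) : Prop :=
  ∃ (M : Type) (_ : Fintype M) (A : MooreMachine G i M) (σ : Strategy G i),
    Fintype.card M = s ∧ A.Encodes σ ∧ σ.IsWinning Ω v₀

/-- The order on priorities: `c ⪯ c'` iff `c` is even and `c ≤ c'`. -/
def PrioLE (c c' : ℕ) : Prop := Even c ∧ c ≤ c'

/-- The suffix `π[i, ∞]`. -/
def suffix (π : ℕ → V) (i : ℕ) : ℕ → V := fun k => π (i + k)

namespace GameStructure

variable (G : GameStructure V) (lam : ℕ) (p : V → ℕ)

/-- Direct fixed parity-response. -/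
def DirFixPR : Set (ℕ → V) :=
  {π | π ∈ G.plays ∧ ∀ j, ∃ l < lam, PrioLE (p (π (j + l))) (p (π j))}

/-- Direct fixed window parity. -/
def DirFixWP : Set (ℕ → V) :=
  {π | π ∈ G.plays ∧ ∀ j, ∃ l < lam, ∀ k ≤ l, PrioLE (p (π (j + l))) (p (π (j + k)))}

def FixPR : Set (ℕ → V) := {π | π ∈ G.plays ∧ ∃ i, suffix π i ∈ G.DirFixPR lam p}

def FixWP : Set (ℕ → V) := {π | π ∈ G.plays ∧ ∃ i, suffix π i ∈ G.DirFixWP lam p}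

def DirBndPR : Set (ℕ → V) := {π | π ∈ G.plays ∧ ∃ b > 0, π ∈ G.DirFixPR b p}

def DirBndWP : Set (ℕ → V) := {π | π ∈ G.plays ∧ ∃ b > 0, π ∈ G.DirFixWP b p}

def BndPR : Set (ℕ → V) := {π | π ∈ G.plays ∧ ∃ i, suffix π i ∈ G.DirBndPR p}

def BndWP : Set (ℕ → V) := {π | π ∈ G.plays ∧ ∃ i, suffix π i ∈ G.DirBndWP p}

end GameStructure

/-- The eight types of objectives. -/
inductive ObjectiveType where
  | DirFixPR | DirFixWP | FixPR | FixWP | DirBndPR | DirBndWP | BndPR | BndWP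

/-- The one-dimension objective of the given type; `lam` plays no role for the bounded types. -/
def GameStructure.objective (G : GameStructure V) (lam : ℕ) (p : V → ℕ) :
    ObjectiveType → Set (ℕ → V)
  | .DirFixPR => G.DirFixPR lam p
  | .DirFixWP => G.DirFixWP lam p
  | .FixPR => G.FixPR lam p
  | .FixWP => G.FixWP lam p
  | .DirBndPR => G.DirBndPR p
  | .DirBndWP => G.DirBndWP p
  | .BndPR => G.BndPR p
  | .BndWP => G.BndWP p

/-- The multi-dimension objective: the intersection, over all dimensions, of the objectives of
one same type. -/
def GameStructure.multiObjective (G : GameStructure V) (X : ObjectiveType) (lam : ℕ) {n : ℕ}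
    (p : Fin n → V → ℕ) : Set (ℕ → V) :=
  ⋂ m, G.objective lam (p m) X

end WindowParity

/-! With priorities in {0, 1, 2}, priority 1 is a request, 0 its only response, and 2 is neutral. If
every request is answered within `lam` steps, all eight objectives hold
(`mem_objective_of_answered`); conversely each of them forces requests to be answered in bounded
time from some point on (`eventually_answered_of_mem_objective`). So one construction per player
serves all types at once.

Both lower bounds are pigeonhole arguments: a machine with fewer than `2 ^ N` states confuses two
strings of `N` bits (`exists_collision`), and a spoiler who knows the machine exploits a position
where they differ, again in every round.

Player one: in `echoGame`, each of `N` bits chosen by player two is a request that only its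
repetition answers. Storing the bits wins. A small machine misses a repetition in each round, and
the spoiler then idles longer and longer, so that even the bounded objectives fail
(`exists_unanswered_of_small`).

Player two: in `recallGame`, a round issues a request in every dimension `(j, b)`. The choices of
player one answer the dimensions that contradict the chosen bits, and a reply answers all dimensions
except its own. A correct reply leaves its own dimension unanswered; a wrong reply names a dimension
that is already answered, so nothing stays open. Storing the bits lets player two spoil every round:
leaving at once defeats the fixed types, waiting forever the direct bounded ones, and waiting for
doubling durations all types, with unbounded memory. A small machine can be made to reply wrongly in
each round (`exists_answered_of_small`), which makes all eight objectives true. -/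

namespace WindowParity

/-! ### Winning strategies in terms of consistent plays. -/

section Plays

variable {V : Type*} {G : GameStructure V}

/-- The play `π` follows the strategy `σ` wherever it is in a vertex of player `i`. -/
def Strategy.Consistent {i : Player} (σ : Strategy G i) (π : ℕ → V) : Prop :=
  ∀ t (h : G.owner (π t) = i), π (t + 1) = σ.move ((List.range t).map π) ⟨π t, h⟩

open Classical in
/-- The strategy that moves along `π` whenever this is legal. -/
noncomputable def Strategy.follow (G : GameStructure V) (i : Player) (π : ℕ → V) :
    Strategy G i where
  move ρ v := if G.E v.1 (π (ρ.length + 1)) then π (ρ.length + 1)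
    else (G.no_deadlock v.1).choose
  legal ρ v := by
    split_ifs with h
    · exact h
    · exact (G.no_deadlock v.1).choose_spec

theorem GameStructure.next_of_owner_one (σ₁ : Strategy G .one) (σ₂ : Strategy G .two)
    (ρ : List V) (v : V) (h : G.owner v = .one) : G.next σ₁ σ₂ ρ v = σ₁.move ρ ⟨v, h⟩ := by
  unfold GameStructure.next
  split
  · rfl
  · next h' => rw [h] at h'; cases h'

theorem GameStructure.next_of_owner_two (σ₁ : Strategy G .one) (σ₂ : Strategy G .two)
    (ρ : List V) (v : V) (h : G.owner v = .two) : G.next σ₁ σ₂ ρ v = σ₂.move ρ ⟨v, h⟩ := by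
  unfold GameStructure.next
  split
  · next h' => rw [h] at h'; cases h'
  · rfl

theorem GameStructure.outcomeHistory_fst (v₀ : V) (σ₁ : Strategy G .one)
    (σ₂ : Strategy G .two) (t : ℕ) :
    (G.outcomeHistory v₀ σ₁ σ₂ t).1 = (List.range t).map (G.outcome v₀ σ₁ σ₂) := by
  induction t with
  | zero => rfl
  | succ t ih =>
    rw [List.range_succ, List.map_append, ← ih]
    rfl

theorem GameStructure.outcome_succ (v₀ : V) (σ₁ : Strategy G .one) (σ₂ : Strategy G .two)
    (t : ℕ) : G.outcome v₀ σ₁ σ₂ (t + 1) =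
      G.next σ₁ σ₂ ((List.range t).map (G.outcome v₀ σ₁ σ₂)) (G.outcome v₀ σ₁ σ₂ t) := by
  rw [← GameStructure.outcomeHistory_fst]
  rfl

theorem GameStructure.outcome_mem_plays (v₀ : V) (σ₁ : Strategy G .one)
    (σ₂ : Strategy G .two) : G.outcome v₀ σ₁ σ₂ ∈ G.plays := by
  intro t
  rw [G.outcome_succ]
  cases h : G.owner (G.outcome v₀ σ₁ σ₂ t) with
  | one => rw [G.next_of_owner_one _ _ _ _ h]; exact σ₁.legal _ ⟨_, h⟩
  | two => rw [G.next_of_owner_two _ _ _ _ h]; exact σ₂.legal _ ⟨_, h⟩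

theorem Strategy.consistent_outcome_one (v₀ : V) (σ₁ : Strategy G .one)
    (σ₂ : Strategy G .two) : σ₁.Consistent (G.outcome v₀ σ₁ σ₂) := by
  intro t h
  rw [G.outcome_succ, G.next_of_owner_one _ _ _ _ h]

theorem Strategy.consistent_outcome_two (v₀ : V) (σ₁ : Strategy G .one)
    (σ₂ : Strategy G .two) : σ₂.Consistent (G.outcome v₀ σ₁ σ₂) := by
  intro t h
  rw [G.outcome_succ, G.next_of_owner_two _ _ _ _ h]

theorem Strategy.follow_move {i : Player} {π : ℕ → V} (hπ : π ∈ G.plays) (t : ℕ)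
    (h : G.owner (π t) = i) :
    (Strategy.follow G i π).move ((List.range t).map π) ⟨π t, h⟩ = π (t + 1) := by
  simp [Strategy.follow, hπ t]

/-- A play that is consistent with both strategies is their outcome. -/
theorem GameStructure.outcome_eq {v₀ : V} {σ₁ : Strategy G .one} {σ₂ : Strategy G .two}
    {π : ℕ → V} (h0 : π 0 = v₀) (h1 : σ₁.Consistent π) (h2 : σ₂.Consistent π) :
    G.outcome v₀ σ₁ σ₂ = π := by
  have key : ∀ t, ∀ s ≤ t, G.outcome v₀ σ₁ σ₂ s = π s := by
    intro t
    induction t with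
    | zero =>
      intro s hs
      obtain rfl : s = 0 := by omega
      exact h0.symm
    | succ t ih =>
      intro s hs
      rcases Nat.lt_or_ge s (t + 1) with hlt | hge
      · exact ih s (by omega)
      · obtain rfl : s = t + 1 := by omega
        have hm : (List.range t).map (G.outcome v₀ σ₁ σ₂) = (List.range t).map π :=
          List.map_congr_left fun a ha => ih a (by have := List.mem_range.1 ha; omega)
        rw [G.outcome_succ, hm, ih t le_rfl]
        cases h : G.owner (π t) with
        | one => rw [G.next_of_owner_one _ _ _ _ h, h1 t h]
        | two => rw [G.next_of_owner_two _ _ _ _ h, h2 t h]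
  funext t
  exact key t t le_rfl

/-- Every play consistent with `σ` is realised by an opponent who simply follows it, so opposing
strategies can be replaced by plays. -/
theorem Strategy.isWinning_one_iff {σ : Strategy G .one} {Ω : Set (ℕ → V)} {v₀ : V} :
    σ.IsWinning Ω v₀ ↔ ∀ π ∈ G.plays, π 0 = v₀ → σ.Consistent π → π ∈ Ω := by
  constructor
  · intro h π hπ h0 hc
    have := h (Strategy.follow G .two π)
    rwa [GameStructure.outcome_eq h0 hc fun t ht => (Strategy.follow_move hπ t ht).symm] at this
  · intro h σ₂
    exact h _ (G.outcome_mem_plays v₀ σ σ₂) rfl (Strategy.consistent_outcome_one v₀ σ σ₂)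

theorem Strategy.isWinning_two_iff {σ : Strategy G .two} {Ω : Set (ℕ → V)} {v₀ : V} :
    σ.IsWinning Ω v₀ ↔ ∀ π ∈ G.plays, π 0 = v₀ → σ.Consistent π → π ∉ Ω := by
  constructor
  · intro h π hπ h0 hc
    have := h (Strategy.follow G .one π)
    rw [GameStructure.outcome_eq h0 (fun t ht => (Strategy.follow_move hπ t ht).symm) hc] at this
    exact this.2
  · intro h σ₁
    exact ⟨G.outcome_mem_plays v₀ σ₁ σ, h _ (G.outcome_mem_plays v₀ σ₁ σ) rfl
      (Strategy.consistent_outcome_two v₀ σ₁ σ)⟩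

end Plays

/-! ### Moore machines, spoilers who know the machine, and the pigeonhole principle. -/

section Machines

variable {V : Type*} {G : GameStructure V} {i : Player} {M : Type*}

/-- The memory of the machine just before it reads `π t`. -/
def MooreMachine.memory (A : MooreMachine G i M) (π : ℕ → V) : ℕ → M
  | 0 => A.init
  | t + 1 => A.update (A.memory π t) (π t)

theorem MooreMachine.foldl_eq_memory (A : MooreMachine G i M) (π : ℕ → V) (t : ℕ) :
    ((List.range t).map π).foldl A.update A.init = A.memory π t := by
  induction t with
  | zero => rfl
  | succ t ih =>
    rw [List.range_succ, List.map_append, List.foldl_append, ih]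
    rfl

theorem MooreMachine.Encodes.consistent_iff {A : MooreMachine G i M} {σ : Strategy G i}
    (hA : A.Encodes σ) {π : ℕ → V} : σ.Consistent π ↔
      ∀ t (h : G.owner (π t) = i), π (t + 1) = A.action (A.memory π t) ⟨π t, h⟩ := by
  unfold Strategy.Consistent
  refine forall_congr' fun t => forall_congr' fun h => ?_
  rw [hA, A.foldl_eq_memory]

/-- The strategy that a machine with legal actions encodes. -/
def MooreMachine.toStrategy (A : MooreMachine G i M) (hA : ∀ m v, G.E v.1 (A.action m v)) :
    Strategy G i where
  move ρ v := A.action (ρ.foldl A.update A.init) v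
  legal _ v := hA _ v

theorem MooreMachine.encodes_toStrategy (A : MooreMachine G i M)
    (hA : ∀ m v, G.E v.1 (A.action m v)) : A.Encodes (A.toStrategy hA) := fun _ _ => rfl

/-- The configurations (memory, vertex, spoiler data) of the game between the machine `A` and a
spoiler that controls the vertices of the opponent by means of `d`. -/
noncomputable def MooreMachine.spoil {X : Type*} (A : MooreMachine G i M)
    (d : ℕ → M → V → X → V × X) (v₀ : V) (x₀ : X) : ℕ → M × V × X
  | 0 => (A.init, v₀, x₀)
  | t + 1 =>
    let c := A.spoil d v₀ x₀ t
    (A.update c.1 c.2.1,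
      open Classical in
      if h : G.owner c.2.1 = i then A.action c.1 ⟨c.2.1, h⟩ else (d t c.1 c.2.1 c.2.2).1,
      (d t c.1 c.2.1 c.2.2).2)

section Spoil

variable {X : Type*} (A : MooreMachine G i M) (d : ℕ → M → V → X → V × X) (v₀ : V) (x₀ : X)

/-- The sequence of vertices in `MooreMachine.spoil`. -/
noncomputable def MooreMachine.spoilPlay (t : ℕ) : V := (A.spoil d v₀ x₀ t).2.1

/-- The sequence of spoiler data in `MooreMachine.spoil`. -/
noncomputable def MooreMachine.spoilData (t : ℕ) : X := (A.spoil d v₀ x₀ t).2.2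

theorem MooreMachine.spoil_fst (t : ℕ) :
    (A.spoil d v₀ x₀ t).1 = A.memory (A.spoilPlay d v₀ x₀) t := by
  induction t with
  | zero => rfl
  | succ t ih =>
    rw [MooreMachine.memory, ← ih]
    rfl

theorem MooreMachine.spoilPlay_succ_of_owner (t : ℕ)
    (h : G.owner (A.spoilPlay d v₀ x₀ t) = i) : A.spoilPlay d v₀ x₀ (t + 1) =
      A.action (A.memory (A.spoilPlay d v₀ x₀) t) ⟨A.spoilPlay d v₀ x₀ t, h⟩ := by
  rw [← A.spoil_fst]
  exact dif_pos h

theorem MooreMachine.spoilPlay_succ_of_ne (t : ℕ)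
    (h : G.owner (A.spoilPlay d v₀ x₀ t) ≠ i) : A.spoilPlay d v₀ x₀ (t + 1) =
      (d t (A.memory (A.spoilPlay d v₀ x₀) t) (A.spoilPlay d v₀ x₀ t)
        (A.spoilData d v₀ x₀ t)).1 := by
  rw [← A.spoil_fst]
  exact dif_neg h

theorem MooreMachine.spoilData_succ (t : ℕ) : A.spoilData d v₀ x₀ (t + 1) =
      (d t (A.memory (A.spoilPlay d v₀ x₀) t) (A.spoilPlay d v₀ x₀ t)
        (A.spoilData d v₀ x₀ t)).2 := by
  rw [← A.spoil_fst]
  rfl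

/-- If the spoiler moves legally, then the result is a play that is consistent with the
strategy that the machine encodes. -/
theorem MooreMachine.Encodes.spoilPlay_mem {A : MooreMachine G i M} {σ : Strategy G i}
    (hA : A.Encodes σ) (hd : ∀ t m v x, G.owner v ≠ i → G.E v (d t m v x).1) :
    A.spoilPlay d v₀ x₀ ∈ G.plays ∧ σ.Consistent (A.spoilPlay d v₀ x₀) := by
  have hc : σ.Consistent (A.spoilPlay d v₀ x₀) :=
    hA.consistent_iff.2 fun t h => A.spoilPlay_succ_of_owner d v₀ x₀ t h
  refine ⟨fun t => ?_, hc⟩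
  by_cases h : G.owner (A.spoilPlay d v₀ x₀ t) = i
  · rw [hc t h]
    exact σ.legal _ ⟨_, h⟩
  · rw [A.spoilPlay_succ_of_ne d v₀ x₀ t h]
    exact hd _ _ _ _ h

end Spoil

/-- The memory reached from `m` after reading `f 0, …, f (q - 1)`. -/
def MooreMachine.read (A : MooreMachine G i M) (m : M) (f : ℕ → V) : ℕ → M
  | 0 => m
  | q + 1 => A.update (A.read m f q) (f q)

theorem MooreMachine.memory_add (A : MooreMachine G i M) (π : ℕ → V) (s t : ℕ) :
    A.memory π (s + t) = A.read (A.memory π s) (fun q => π (s + q)) t := by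
  induction t with
  | zero => rfl
  | succ t ih => rw [← add_assoc, MooreMachine.memory, MooreMachine.read, ih]

theorem MooreMachine.read_congr (A : MooreMachine G i M) (m : M) {f g : ℕ → V} {n : ℕ}
    (h : ∀ q < n, f q = g q) : A.read m f n = A.read m g n := by
  induction n with
  | zero => rfl
  | succ n ih =>
    rw [MooreMachine.read, MooreMachine.read, ih fun q hq => h q (by omega), h n (by omega)]

open Classical in
/-- The configurations that the machine runs through from memory `m` and vertex `v`, as long as
only its own vertices are visited. -/
noncomputable def MooreMachine.drive (A : MooreMachine G i M) (m : M) (v : V) : ℕ → M × V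
  | 0 => (m, v)
  | n + 1 =>
    let c := A.drive m v n
    (A.update c.1 c.2, if h : G.owner c.2 = i then A.action c.1 ⟨c.2, h⟩ else c.2)

/-- While the machine alone moves, the play depends only on the current memory and vertex; hence
histories that lead to the same memory are continued in the same way. -/
theorem MooreMachine.Encodes.drive_eq {A : MooreMachine G i M} {σ : Strategy G i}
    (hA : A.Encodes σ) {π : ℕ → V} (hπ : σ.Consistent π) {s n : ℕ}
    (h : ∀ q < n, G.owner (π (s + q)) = i) :
    A.drive (A.memory π s) (π s) n = (A.memory π (s + n), π (s + n)) := by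
  induction n with
  | zero => rfl
  | succ n ih =>
    have ho := h n (by omega)
    rw [MooreMachine.drive, ih fun q hq => h q (by omega), ← add_assoc,
      hA.consistent_iff.1 hπ _ ho, MooreMachine.memory]
    simp only [ho, dite_true]

/-- A function of `N` bits with fewer than `2 ^ N` values identifies two bit strings. -/
theorem exists_collision [Fintype M] {N : ℕ} (hM : Fintype.card M < 2 ^ N)
    (F : (Fin N → Bool) → M) : ∃ x y, ∃ j, F x = F y ∧ x j ≠ y j := by
  obtain ⟨x, y, hne, h⟩ := Fintype.exists_ne_map_eq_of_card_lt F (by simpa using hM)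
  obtain ⟨j, hj⟩ := Function.ne_iff.1 hne
  exact ⟨x, y, j, h, hj⟩

end Machines

/-! ### Reduction of the eight objectives to requests and responses. -/

section Objectives

variable {V : Type*} {G : GameStructure V}

/-- Lets the dimensions be indexed by pairs (stage, bit) instead of `Fin n`. -/
theorem mem_multiObjective {ι : Type*} {n : ℕ} (e : Fin n ≃ ι) {p : ι → V → ℕ}
    {X : ObjectiveType} {lam : ℕ} {π : ℕ → V} :
    π ∈ G.multiObjective X lam (fun m => p (e m)) ↔ ∀ a, π ∈ G.objective lam (p a) X := by
  simp only [GameStructure.multiObjective, Set.mem_iInter]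
  exact e.forall_congr_left.trans (by simp)

/-- Priorities 0 and 2 are even and answer themselves with `l = 0`, so only priority 1 needs a
response. -/
theorem mem_DirFixPR_of_answered {p : V → ℕ} (hp : ∀ v, p v ≤ 2) {lam : ℕ} (hl : 1 ≤ lam)
    {π : ℕ → V} (hπ : π ∈ G.plays)
    (h : ∀ t, p (π t) = 1 → ∃ l < lam, p (π (t + l)) = 0) : π ∈ G.DirFixPR lam p := by
  refine ⟨hπ, fun j => ?_⟩
  by_cases h1 : p (π j) = 1
  · obtain ⟨l, hl, h0⟩ := h j h1
    exact ⟨l, hl, by rw [h0]; exact ⟨Even.zero, Nat.zero_le _⟩⟩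
  · refine ⟨0, hl, ?_, le_rfl⟩
    have := hp (π j)
    generalize p (π j) = c at *
    interval_cases c <;> first | decide | contradiction

/-- A response has priority 0, which lies below every priority met on the way; it therefore closes
the window whatever the window contains. -/
theorem mem_DirFixWP_of_answered {p : V → ℕ} (hp : ∀ v, p v ≤ 2) {lam : ℕ} (hl : 1 ≤ lam)
    {π : ℕ → V} (hπ : π ∈ G.plays)
    (h : ∀ t, p (π t) = 1 → ∃ l < lam, p (π (t + l)) = 0) : π ∈ G.DirFixWP lam p := by
  refine ⟨hπ, fun j => ?_⟩
  by_cases h1 : p (π j) = 1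
  · obtain ⟨l, hl, h0⟩ := h j h1
    exact ⟨l, hl, fun k _ => by rw [h0]; exact ⟨Even.zero, Nat.zero_le _⟩⟩
  · refine ⟨0, hl, fun k hk => ?_⟩
    obtain rfl : k = 0 := by omega
    refine ⟨?_, le_rfl⟩
    have := hp (π j)
    rw [add_zero]
    generalize p (π j) = c at *
    interval_cases c <;> first | decide | contradiction

/-- If every request is answered within `lam` steps, then all eight objectives hold. -/
theorem mem_objective_of_answered {p : V → ℕ} (hp : ∀ v, p v ≤ 2) {lam : ℕ} (hl : 1 ≤ lam)
    {π : ℕ → V} (hπ : π ∈ G.plays)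
    (h : ∀ t, p (π t) = 1 → ∃ l < lam, p (π (t + l)) = 0) (X : ObjectiveType) :
    π ∈ G.objective lam p X := by
  have h1 := mem_DirFixPR_of_answered hp hl hπ h
  have h2 := mem_DirFixWP_of_answered hp hl hπ h
  have h3 : suffix π 0 = π := by funext k; simp [suffix]
  cases X with
  | DirFixPR => exact h1
  | DirFixWP => exact h2
  | FixPR => exact ⟨hπ, 0, by rwa [h3]⟩
  | FixWP => exact ⟨hπ, 0, by rwa [h3]⟩
  | DirBndPR => exact ⟨hπ, lam, hl, h1⟩
  | DirBndWP => exact ⟨hπ, lam, hl, h2⟩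
  | BndPR => exact ⟨hπ, 0, by rw [h3]; exact ⟨hπ, lam, hl, h1⟩⟩
  | BndWP => exact ⟨hπ, 0, by rw [h3]; exact ⟨hπ, lam, hl, h2⟩⟩

theorem answered_of_mem_DirFixPR {p : V → ℕ} {lam : ℕ} {π : ℕ → V}
    (h : π ∈ G.DirFixPR lam p) (t : ℕ) (ht : p (π t) = 1) :
    ∃ l < lam, p (π (t + l)) = 0 := by
  obtain ⟨l, hl, he, hle⟩ := h.2 t
  refine ⟨l, hl, ?_⟩
  rw [ht] at hle
  rcases he with ⟨r, hr⟩
  omega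

theorem DirFixWP_subset_DirFixPR (p : V → ℕ) (lam : ℕ) :
    G.DirFixWP lam p ⊆ G.DirFixPR lam p := fun _ h =>
  ⟨h.1, fun j => let ⟨l, hl, hk⟩ := h.2 j; ⟨l, hl, hk 0 (Nat.zero_le _)⟩⟩

theorem answered_of_suffix_mem {p : V → ℕ} {lam i : ℕ} {π : ℕ → V}
    (h : suffix π i ∈ G.DirFixPR lam p) (t : ℕ) (hit : i ≤ t) (ht : p (π t) = 1) :
    ∃ l < lam, p (π (t + l)) = 0 := by
  obtain ⟨s, rfl⟩ := Nat.exists_eq_add_of_le hit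
  obtain ⟨l, hl, h0⟩ := answered_of_mem_DirFixPR h s ht
  exact ⟨l, hl, by rw [add_assoc]; exact h0⟩

/-- All eight objectives imply that, from some point on, requests are answered in bounded
time. -/
theorem eventually_answered_of_mem_objective {p : V → ℕ} {lam : ℕ} {X : ObjectiveType}
    {π : ℕ → V} (h : π ∈ G.objective lam p X) :
    ∃ i b, ∀ t ≥ i, p (π t) = 1 → ∃ l < b, p (π (t + l)) = 0 := by
  cases X with
  | DirFixPR => exact ⟨0, lam, fun t _ => answered_of_mem_DirFixPR h t⟩
  | DirFixWP => exact ⟨0, lam, fun t _ => answered_of_mem_DirFixPR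
      (DirFixWP_subset_DirFixPR p lam h) t⟩
  | FixPR =>
    obtain ⟨-, i, hi⟩ := h
    exact ⟨i, lam, answered_of_suffix_mem hi⟩
  | FixWP =>
    obtain ⟨-, i, hi⟩ := h
    exact ⟨i, lam, answered_of_suffix_mem (DirFixWP_subset_DirFixPR p lam hi)⟩
  | DirBndPR =>
    obtain ⟨-, b, -, hb⟩ := h
    exact ⟨0, b, fun t _ => answered_of_mem_DirFixPR hb t⟩
  | DirBndWP =>
    obtain ⟨-, b, -, hb⟩ := h
    exact ⟨0, b, fun t _ => answered_of_mem_DirFixPR (DirFixWP_subset_DirFixPR p b hb) t⟩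
  | BndPR =>
    obtain ⟨-, i, -, b, -, hb⟩ := h
    exact ⟨i, b, answered_of_suffix_mem hb⟩
  | BndWP =>
    obtain ⟨-, i, -, b, -, hb⟩ := h
    exact ⟨i, b, answered_of_suffix_mem (DirFixWP_subset_DirFixPR p b hb)⟩

/-- The types with the bound `lam` on the windows. -/
def ObjectiveType.IsFixed (X : ObjectiveType) : Prop :=
  X = .DirFixPR ∨ X = .DirFixWP ∨ X = .FixPR ∨ X = .FixWP

/-- The fixed objectives imply that, from some point on, requests are answered within `lam`
steps. -/
theorem eventually_answered_of_mem_fixed {p : V → ℕ} {lam : ℕ} {X : ObjectiveType}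
    (hX : X.IsFixed) {π : ℕ → V} (h : π ∈ G.objective lam p X) :
    ∃ i, ∀ t ≥ i, p (π t) = 1 → ∃ l < lam, p (π (t + l)) = 0 := by
  rcases hX with rfl | rfl | rfl | rfl
  · exact ⟨0, fun t _ => answered_of_mem_DirFixPR h t⟩
  · exact ⟨0, fun t _ => answered_of_mem_DirFixPR (DirFixWP_subset_DirFixPR p lam h) t⟩
  · obtain ⟨-, i, hi⟩ := h
    exact ⟨i, answered_of_suffix_mem hi⟩
  · obtain ⟨-, i, hi⟩ := h
    exact ⟨i, answered_of_suffix_mem (DirFixWP_subset_DirFixPR p lam hi)⟩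

/-- The direct bounded objectives imply that every request is answered. -/
theorem answered_of_mem_dirBnd {p : V → ℕ} {lam : ℕ} {X : ObjectiveType}
    (hX : X = .DirBndPR ∨ X = .DirBndWP) {π : ℕ → V} (h : π ∈ G.objective lam p X) (t : ℕ)
    (ht : p (π t) = 1) : ∃ l, p (π (t + l)) = 0 := by
  rcases hX with rfl | rfl
  · obtain ⟨-, b, -, hb⟩ := h
    obtain ⟨l, -, h0⟩ := answered_of_mem_DirFixPR hb t ht
    exact ⟨l, h0⟩
  · obtain ⟨-, b, -, hb⟩ := h
    obtain ⟨l, -, h0⟩ := answered_of_mem_DirFixPR (DirFixWP_subset_DirFixPR p b hb) t ht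
    exact ⟨l, h0⟩

/-- If unanswered requests of unbounded duration occur arbitrarily late, then no conjunction of
objectives of a same type holds. -/
theorem not_forall_mem_objective {ι : Type*} [Finite ι] {p : ι → V → ℕ} {lam : ℕ}
    {X : ObjectiveType} {π : ℕ → V}
    (h : ∀ n, ∃ a, ∃ t ≥ n, p a (π t) = 1 ∧ ∀ l < n, p a (π (t + l)) ≠ 0) :
    ¬ ∀ a, π ∈ G.objective lam (p a) X := by
  intro hm
  choose i b hib using fun a => eventually_answered_of_mem_objective (hm a)
  -- The offending dimension may vary with `n`, so bounds uniform over the finitely many dimensions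
  -- are needed.
  obtain ⟨B, hB⟩ := (Set.finite_range i).bddAbove
  obtain ⟨B', hB'⟩ := (Set.finite_range b).bddAbove
  obtain ⟨a, t, ht, h1, h0⟩ := h (max B B')
  obtain ⟨l, hl, hz⟩ := hib a t (((hB ⟨a, rfl⟩).trans (le_max_left _ _)).trans ht) h1
  exact h0 l (hl.trans_le ((hB' ⟨a, rfl⟩).trans (le_max_right _ _))) hz

/-- If requests that stay unanswered for `lam` steps occur arbitrarily late, then no conjunction
of objectives of a same fixed type holds. -/
theorem not_forall_mem_fixed {ι : Type*} [Finite ι] {p : ι → V → ℕ} {lam : ℕ}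
    {X : ObjectiveType} (hX : X.IsFixed) {π : ℕ → V}
    (h : ∀ n, ∃ a, ∃ t ≥ n, p a (π t) = 1 ∧ ∀ l < lam, p a (π (t + l)) ≠ 0) :
    ¬ ∀ a, π ∈ G.objective lam (p a) X := by
  intro hm
  choose i hi using fun a => eventually_answered_of_mem_fixed hX (hm a)
  obtain ⟨B, hB⟩ := (Set.finite_range i).bddAbove
  obtain ⟨a, t, ht, h1, h0⟩ := h B
  obtain ⟨l, hl, hz⟩ := hi a t ((hB ⟨a, rfl⟩).trans ht) h1
  exact h0 l hl hz

end Objectives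

/-- The times at which a patient player stops waiting. -/
def IsLeaveTime (K t : ℕ) : Prop := ∃ a, t = K * 2 ^ a

/-- Leave times double: no leave occurs strictly between `T = K * 2 ^ a` and `2 * T`, which makes
the waits unbounded. -/
theorem not_isLeaveTime {K a t : ℕ} (h1 : K * 2 ^ a < t) (h2 : t < K * 2 ^ (a + 1)) :
    ¬ IsLeaveTime K t := by
  rintro ⟨b, rfl⟩
  have h3 := (Nat.pow_lt_pow_iff_right (by norm_num)).1 (Nat.lt_of_mul_lt_mul_left h1)
  have h4 := (Nat.pow_lt_pow_iff_right (by norm_num)).1 (Nat.lt_of_mul_lt_mul_left h2)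
  omega

theorem not_isLeaveTime_of_lt {K t : ℕ} (h : t < K) : ¬ IsLeaveTime K t := by
  rintro ⟨b, rfl⟩
  have := Nat.one_le_two_pow (n := b)
  nlinarith


/-! ### Player one must repeat bits: exponential memory for player one. -/

section EchoGame

/-- The vertex with position `q` and bit `b`. -/
def node (N q : ℕ) (b : Bool) : Fin (2 * N + 2) × Bool := (Fin.ofNat (2 * N + 2) q, b)

theorem node_pos {N q : ℕ} (h : q < 2 * N + 2) (b : Bool) : ((node N q b).1 : ℕ) = q :=
  Nat.mod_eq_of_lt h

/-- Player two idles at position `0`, then chooses bits at the positions `1, …, N`; player one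
has to repeat these bits at the positions `N + 2, …, 2 * N + 1`. -/
def echoGame (N : ℕ) : GameStructure (Fin (2 * N + 2) × Bool) where
  owner v := if (v.1 : ℕ) ≤ N then .two else .one
  E v v' := (v'.1 : ℕ) = v.1 + 1 ∨ ((v'.1 : ℕ) = 0 ∧ ((v.1 : ℕ) = 0 ∨ (v.1 : ℕ) = 2 * N + 1))
  no_deadlock v := by
    rcases Nat.lt_or_ge v.1 (2 * N + 1) with h | h
    · exact ⟨node N (v.1 + 1) false, Or.inl (node_pos (by omega) _)⟩
    · exact ⟨node N 0 false, Or.inr ⟨node_pos (by omega) _, Or.inr (by omega)⟩⟩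

/-- Dimension `(j, b)`: choosing the bit `b` at stage `j` is a request, repeating it is the
response. -/
def echoPriority (N : ℕ) (a : Fin N × Bool) (v : Fin (2 * N + 2) × Bool) : ℕ :=
  if (v.1 : ℕ) = a.1 + 1 ∧ v.2 = a.2 then 1
  else if (v.1 : ℕ) = N + 2 + a.1 ∧ v.2 = a.2 then 0 else 2

theorem echoPriority_le (N : ℕ) (a : Fin N × Bool) (v : Fin (2 * N + 2) × Bool) :
    echoPriority N a v ≤ 2 := by
  unfold echoPriority
  split_ifs <;> omega

theorem echoPriority_eq_one {N : ℕ} {a : Fin N × Bool} {v : Fin (2 * N + 2) × Bool} :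
    echoPriority N a v = 1 ↔ (v.1 : ℕ) = a.1 + 1 ∧ v.2 = a.2 := by
  unfold echoPriority
  split_ifs with h <;> simp [h]

theorem echoPriority_eq_zero {N : ℕ} {a : Fin N × Bool} {v : Fin (2 * N + 2) × Bool} :
    echoPriority N a v = 0 ↔ (v.1 : ℕ) = N + 2 + a.1 ∧ v.2 = a.2 := by
  unfold echoPriority
  split_ifs with h h'
  · simp only [false_iff, not_and]
    omega
  · simp [h']
  · simp [h']

variable {N : ℕ}

theorem echoGame_owner_one {v : Fin (2 * N + 2) × Bool} :
    (echoGame N).owner v = .one ↔ N < (v.1 : ℕ) := by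
  simp only [echoGame]
  split_ifs with h
  · simp only [false_iff]; omega
  · simp only [true_iff]; omega

/-- Only position `0` allows idling; from position `1` on, the advance to `2 * N + 1` is forced. -/
theorem echoGame_pos_add {π : ℕ → Fin (2 * N + 2) × Bool} (hπ : π ∈ (echoGame N).plays)
    {t q i : ℕ} (ht : ((π t).1 : ℕ) = q) (hq : 1 ≤ q) (hi : q + i ≤ 2 * N + 1) :
    ((π (t + i)).1 : ℕ) = q + i := by
  induction i with
  | zero => exact ht
  | succ i ih =>
    have h := hπ (t + i)
    have := ih (by omega)
    simp only [echoGame] at h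
    rw [← add_assoc]
    omega

/-- The machine that stores the bits chosen by player two and repeats them. -/
def echoMachine (N : ℕ) : MooreMachine (echoGame N) .one (Fin N → Bool) where
  init _ := false
  update m v j := if (v.1 : ℕ) = j + 1 then v.2 else m j
  action m v :=
    if h : N + 1 ≤ (v.1.1 : ℕ) ∧ (v.1.1 : ℕ) ≤ 2 * N then
      node N (v.1.1 + 1) (m ⟨v.1.1 - (N + 1), by omega⟩)
    else node N 0 false

theorem echoMachine_legal (m : Fin N → Bool) (v : {v // (echoGame N).owner v = .one}) :
    (echoGame N).E v.1 ((echoMachine N).action m v) := by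
  have h := echoGame_owner_one.1 v.2
  simp only [echoMachine]
  split_ifs with h'
  · exact Or.inl (node_pos (by omega) _)
  · exact Or.inr ⟨node_pos (by omega) _, Or.inr (by omega)⟩

/-- The bit `j` is overwritten only at position `j + 1`, which does not recur before the round is
over. -/
theorem echoMachine_memory {π : ℕ → Fin (2 * N + 2) × Bool} (hπ : π ∈ (echoGame N).plays)
    {t : ℕ} {j : Fin N} (ht : ((π t).1 : ℕ) = j + 1) {i : ℕ} (hi : j + 1 + i ≤ 2 * N + 1) :
    (echoMachine N).memory π (t + 1 + i) j = (π t).2 := by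
  induction i with
  | zero => simp [MooreMachine.memory, echoMachine, ht]
  | succ i ih =>
    have h := echoGame_pos_add hπ ht (by omega) (i := i + 1) (by omega)
    have h2 := ih (by omega)
    rw [← add_assoc, MooreMachine.memory]
    rw [show t + 1 + i = t + (i + 1) by omega] at *
    simp only [echoMachine] at h2 ⊢
    rw [if_neg (by omega)]
    exact h2

/-- Player one wins all the objectives by repeating the bits. -/
theorem echoStrategy_isWinning (X : ObjectiveType) {n : ℕ} (e : Fin n ≃ Fin N × Bool) :
    ((echoMachine N).toStrategy echoMachine_legal).IsWinning
      ((echoGame N).multiObjective X (N + 2) fun m => echoPriority N (e m)) (node N 0 false) := by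
  rw [Strategy.isWinning_one_iff]
  intro π hπ _ hc
  rw [mem_multiObjective e]
  intro a
  refine mem_objective_of_answered (echoPriority_le N a) (by omega) hπ (fun t ht => ?_) X
  rw [echoPriority_eq_one] at ht
  obtain ⟨hp, hb⟩ := ht
  -- The request at position `j + 1` is answered at position `N + 2 + j`, hence after `N + 1` steps;
  -- this is why `lam = N + 2`.
  refine ⟨N + 1, by omega, ?_⟩
  have ha := a.1.2
  have hpos := echoGame_pos_add hπ hp (by omega) (i := N) (by omega)
  have hmem := echoMachine_memory hπ hp (i := N - 1) (by omega)
  have ho : (echoGame N).owner (π (t + N)) = .one := echoGame_owner_one.2 (by omega)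
  have hnext := ((echoMachine N).encodes_toStrategy echoMachine_legal).consistent_iff.1 hc _ ho
  rw [show t + 1 + (N - 1) = t + N by omega] at hmem
  have hcond : N + 1 ≤ ((π (t + N)).1 : ℕ) ∧ ((π (t + N)).1 : ℕ) ≤ 2 * N := by omega
  have hidx : (⟨(π (t + N)).1 - (N + 1), by omega⟩ : Fin N) = a.1 := by
    apply Fin.ext
    simp only
    omega
  rw [← add_assoc, echoPriority_eq_zero, hnext]
  simp only [echoMachine, hcond, and_self, dite_true, hidx] at hmem ⊢
  rw [node_pos (by omega)]
  exact ⟨by omega, hmem.trans hb⟩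

variable {M : Type*} {A : MooreMachine (echoGame N) .one M}

/-- From every memory state, a small machine has a bit string that it fails to repeat. -/
theorem exists_not_echoed [Fintype M] (hM : Fintype.card M < 2 ^ N) (m : M) :
    ∃ x : ℕ → Bool, (∀ q ≥ N, x q = false) ∧ ∃ j < N,
      (A.drive (A.read m (fun q => node N (q + 1) (x q)) N) (node N (N + 1) false)
        (j + 1)).2 ≠ node N (N + 2 + j) (x j) := by
  -- Padding with `false` fixes the bit at position `N + 1`, so both strings hand over to the
  -- machine at the same vertex.
  let ext : (Fin N → Bool) → ℕ → Bool := fun x q => if h : q < N then x ⟨q, h⟩ else false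
  have hext : ∀ x, ∀ q ≥ N, ext x q = false := fun x q hq => dif_neg (by omega)
  obtain ⟨x, y, j, hF, hj⟩ := exists_collision hM
    fun x => A.read m (fun q => node N (q + 1) (ext x q)) N
  -- Both strings lead to the same continuation, which cannot repeat both `x j` and `y j`.
  by_cases hx : (A.drive (A.read m (fun q => node N (q + 1) (ext x q)) N)
      (node N (N + 1) false) (j + 1)).2 = node N (N + 2 + j) (ext x j)
  · refine ⟨ext y, hext y, j, j.2, fun hy => hj ?_⟩
    have hF' : A.read m (fun q => node N (q + 1) (ext x q)) N =
      A.read m (fun q => node N (q + 1) (ext y q)) N := hF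
    rw [← hF', hx] at hy
    have := congrArg Prod.snd hy
    simpa [node, ext] using this
  · exact ⟨ext x, hext x, j, j.2, hx⟩

open Classical in
/-- The spoiler idles until the next leave time, and then chooses bits that the machine fails to
repeat. -/
noncomputable def echoSpoiler (A : MooreMachine (echoGame N) .one M) (bad : M → ℕ → Bool)
    (t : ℕ) (m : M) (v : Fin (2 * N + 2) × Bool) (x : ℕ → Bool) :
    (Fin (2 * N + 2) × Bool) × (ℕ → Bool) :=
  if (v.1 : ℕ) = 0 then
    -- `A.update m v` is the memory with which the machine will arrive at position `1`; the bad
    -- string is chosen for that memory.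
    if IsLeaveTime (2 * N + 2) t then (node N 1 (bad (A.update m v) 0), bad (A.update m v))
    else (node N 0 false, x)
  else (node N (v.1 + 1) (x v.1), x)

theorem echoSpoiler_legal (bad : M → ℕ → Bool) (t : ℕ) (m : M) (v : Fin (2 * N + 2) × Bool)
    (x : ℕ → Bool) (h : (echoGame N).owner v ≠ .one) :
    (echoGame N).E v (echoSpoiler A bad t m v x).1 := by
  rw [Ne, echoGame_owner_one] at h
  unfold echoSpoiler
  split_ifs with h0 h1
  · exact Or.inl (by rw [node_pos (by omega)]; omega)
  · exact Or.inr ⟨node_pos (by omega) _, Or.inl h0⟩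
  · exact Or.inl (node_pos (by omega) _)

/-- Against a small machine, player two can produce requests of unbounded duration. -/
theorem exists_unanswered_of_small [Fintype M] (hM : Fintype.card M < 2 ^ N)
    {σ : Strategy (echoGame N) .one} (hA : A.Encodes σ) :
    ∃ π ∈ (echoGame N).plays, π 0 = node N 0 false ∧ σ.Consistent π ∧
      ∀ n, ∃ a, ∃ t ≥ n, echoPriority N a (π t) = 1 ∧
        ∀ l < n, echoPriority N a (π (t + l)) ≠ 0 := by
  choose bad hbad0 hbad using exists_not_echoed (A := A) hM
  let x₀ : ℕ → Bool := fun _ => false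
  let d := echoSpoiler A bad
  obtain ⟨hπ, hc⟩ := hA.spoilPlay_mem d (node N 0 false) x₀
    (fun t m v x h => echoSpoiler_legal bad t m v x h)
  have hsucc := A.spoilPlay_succ_of_ne d (node N 0 false) x₀
  have hdata := A.spoilData_succ d (node N 0 false) x₀
  have hzero : A.spoilPlay d (node N 0 false) x₀ 0 = node N 0 false := rfl
  generalize A.spoilPlay d (node N 0 false) x₀ = π at *
  generalize A.spoilData d (node N 0 false) x₀ = D at *
  refine ⟨π, hπ, hzero, hc, ?_⟩
  have idle : ∀ s i, ((π s).1 : ℕ) = 0 →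
      (∀ u, s ≤ u → u < s + i → ¬ IsLeaveTime (2 * N + 2) u) → ((π (s + i)).1 : ℕ) = 0 := by
    intro s i hs
    induction i with
    | zero => exact fun _ => hs
    | succ i ih =>
      intro h
      have h0 := ih fun u h1 h2 => h u h1 (by omega)
      have h1 := h (s + i) (by omega) (by omega)
      rw [← add_assoc, hsucc _ (by rw [Ne, echoGame_owner_one]; omega)]
      simp only [d, echoSpoiler, h0, h1, if_true, if_false]
      exact node_pos (by omega) _
  have round : ∀ T, ((π T).1 : ℕ) = 0 → IsLeaveTime (2 * N + 2) T → ∀ q ≤ N,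
      π (T + 1 + q) = node N (q + 1) (bad (A.memory π (T + 1)) q) ∧
        D (T + 1 + q) = bad (A.memory π (T + 1)) := by
    intro T hT hl q
    induction q with
    | zero =>
      intro _
      rw [add_zero, hsucc _ (by rw [Ne, echoGame_owner_one]; omega), hdata]
      simp only [d, echoSpoiler, hT, hl, if_true]
      exact ⟨rfl, rfl⟩
    | succ q ih =>
      intro hq
      obtain ⟨h1, h2⟩ := ih (by omega)
      have hp : ((π (T + 1 + q)).1 : ℕ) = q + 1 := by rw [h1, node_pos (by omega)]
      rw [← add_assoc, hsucc _ (by rw [Ne, echoGame_owner_one]; omega), hdata]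
      simp only [d, echoSpoiler, hp, h2]
      exact ⟨rfl, rfl⟩
  have pos : ∀ T, ((π T).1 : ℕ) = 0 → IsLeaveTime (2 * N + 2) T → ∀ i ≤ 2 * N,
      ((π (T + 1 + i)).1 : ℕ) = i + 1 := by
    intro T hT hl i hi
    have h1 : ((π (T + 1)).1 : ℕ) = 1 := by
      have := (round T hT hl 0 (by omega)).1
      rw [add_zero] at this
      rw [this, node_pos (by omega)]
    rw [echoGame_pos_add hπ h1 le_rfl (by omega)]
    omega
  -- A round started at the leave time `T` is back at position `0` after `2 * N + 2 ≤ T` steps, and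
  -- idles there until `2 * T`.
  have rest : ∀ a i, ((π ((2 * N + 2) * 2 ^ a)).1 : ℕ) = 0 → 2 * N + 2 ≤ i →
      i ≤ (2 * N + 2) * 2 ^ a → ((π ((2 * N + 2) * 2 ^ a + i)).1 : ℕ) = 0 := by
    intro a i hT hi hi'
    set T := (2 * N + 2) * 2 ^ a with hTdef
    have hlast := pos T hT ⟨a, rfl⟩ (2 * N) le_rfl
    have hback : ((π (T + (2 * N + 2))).1 : ℕ) = 0 := by
      have := hπ (T + 1 + 2 * N)
      simp only [echoGame] at this
      rw [show T + 1 + 2 * N + 1 = T + (2 * N + 2) by omega] at this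
      have := (π (T + (2 * N + 2))).1.2
      omega
    have := idle (T + (2 * N + 2)) (i - (2 * N + 2)) hback fun u h1 h2 =>
      not_isLeaveTime (a := a) (by omega) (by rw [pow_succ, ← mul_assoc]; omega)
    rwa [show T + (2 * N + 2) + (i - (2 * N + 2)) = T + i by omega] at this
  have start : ∀ a, ((π ((2 * N + 2) * 2 ^ a)).1 : ℕ) = 0 := by
    intro a
    induction a with
    | zero =>
      have := idle 0 (2 * N + 2) (by rw [hzero, node_pos (by omega)])
        fun u _ h => not_isLeaveTime_of_lt (by omega)
      simpa using this
    | succ a ih =>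
      have h := rest a ((2 * N + 2) * 2 ^ a) ih
        (Nat.le_mul_of_pos_right _ (Nat.two_pow_pos a)) le_rfl
      rwa [← mul_two, mul_assoc, ← pow_succ] at h
  intro n
  -- The leave time of index `n` is so late that the `n` steps following a request of its round end
  -- before the next round starts.
  have hT := start n
  have hrest := rest n
  have hn : n < 2 ^ n := Nat.lt_two_pow_self
  have hTn : 2 * N + 2 + n ≤ (2 * N + 2) * 2 ^ n + 1 := by nlinarith
  have hl : IsLeaveTime (2 * N + 2) ((2 * N + 2) * 2 ^ n) := ⟨n, rfl⟩
  generalize (2 * N + 2) * 2 ^ n = T at *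
  obtain ⟨j, hj, hne⟩ := hbad (A.memory π (T + 1))
  have hround := round T hT hl
  have hpos := pos T hT hl
  set x := bad (A.memory π (T + 1)) with hx
  have hmem : A.memory π (T + 1 + N) =
      A.read (A.memory π (T + 1)) (fun q => node N (q + 1) (x q)) N := by
    rw [A.memory_add]
    exact A.read_congr _ fun q hq => (hround q hq.le).1
  have hN := (hround N le_rfl).1
  rw [show x N = false from hbad0 _ N le_rfl] at hN
  have hdrive := hA.drive_eq hc (s := T + 1 + N) (n := j + 1) fun q hq => by
    rw [echoGame_owner_one, add_assoc, hpos _ (by omega)]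
    omega
  rw [hmem, hN] at hdrive
  rw [hdrive] at hne
  refine ⟨(⟨j, hj⟩, x j), T + 1 + j, by omega, ?_, fun l hl' h0 => ?_⟩
  · rw [echoPriority_eq_one, (hround j hj.le).1, node_pos (by omega)]
    exact ⟨rfl, rfl⟩
  · rw [echoPriority_eq_zero] at h0
    obtain ⟨h1, h2⟩ := h0
    simp only at h1 h2
    -- Idling at position `0` answers nothing, and within the round only position `N + 2 + j`,
    -- reached at `l = N + 1`, could answer; there the machine shows the wrong bit.
    rcases Nat.lt_or_ge (2 * N) (j + l) with hlt | hge
    · have := hrest (1 + j + l) hT (by omega) (by omega)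
      rw [show T + (1 + j + l) = T + 1 + j + l by omega] at this
      omega
    · have := hpos (j + l) hge
      rw [show T + 1 + (j + l) = T + 1 + j + l by omega] at this
      obtain rfl : l = N + 1 := by omega
      apply hne
      rw [show T + 1 + N + (j + 1) = T + 1 + j + (N + 1) by omega]
      refine Prod.ext (Fin.ext ?_) h2
      rw [h1, node_pos (by omega)]

/-- A winning strategy of player one with finite memory has at least `2 ^ N` states. -/
theorem echoGame_memory_lower_bound {X : ObjectiveType} {n : ℕ} (e : Fin n ≃ Fin N × Bool)
    {lam s : ℕ} (h : (echoGame N).WinsWithMemory .one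
      ((echoGame N).multiObjective X lam fun m => echoPriority N (e m)) (node N 0 false) s) :
    2 ^ N ≤ s := by
  obtain ⟨M, _, A, σ, rfl, hA, hσ⟩ := h
  by_contra! hM
  obtain ⟨π, hπ, h0, hc, hun⟩ := exists_unanswered_of_small hM hA
  exact not_forall_mem_objective hun
    ((mem_multiObjective e).1 (Strategy.isWinning_one_iff.1 hσ π hπ h0 hc))

end EchoGame


/-! ### Player two must recall a bit: exponential memory for player two. -/

section RecallGame

/-- The vertices of the game in which player two has to recall one of `k + 1` bits. -/
inductive RecallVertex (k : ℕ) where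
  | init
  | choose (j : Fin (k + 1)) (b : Bool)
  | ask (j : Fin (k + 1))
  | reply (j : Fin (k + 1)) (b : Bool)

namespace RecallVertex

variable {k : ℕ}

/-- A code for the vertices. -/
def code : RecallVertex k → Fin (k + 1) × Fin 6
  | init => (0, 0)
  | choose j false => (j, 1)
  | choose j true => (j, 2)
  | ask j => (j, 3)
  | reply j false => (j, 4)
  | reply j true => (j, 5)

theorem code_injective : Function.Injective (code (k := k)) := by
  intro v w h
  rcases v with _ | ⟨j, _ | _⟩ | j | ⟨j, _ | _⟩ <;>
    rcases w with _ | ⟨j', _ | _⟩ | j' | ⟨j', _ | _⟩ <;> simp_all [code]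

noncomputable instance : Fintype (RecallVertex k) := Fintype.ofInjective code code_injective

theorem card_le : Fintype.card (RecallVertex k) ≤ 6 * (k + 1) := by
  have := Fintype.card_le_of_injective _ (code_injective (k := k))
  rw [Fintype.card_prod, Fintype.card_fin, Fintype.card_fin] at this
  omega

end RecallVertex

open RecallVertex

/-- Player one chooses `k + 1` bits and asks for one of them; player two replies with a bit, and
may then wait before the next round. -/
def recallGame (k : ℕ) : GameStructure (RecallVertex k) where
  owner
    | init => .one
    | choose _ _ => .one
    | ask _ => .two
    | reply _ _ => .two
  E
    | init, choose j _ => (j : ℕ) = 0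
    | choose j _, choose j' _ => (j' : ℕ) = j + 1
    | choose j _, ask _ => (j : ℕ) = k
    | ask j, reply j' _ => j' = j
    | reply j b, reply j' b' => j' = j ∧ b' = b
    | reply _ _, init => True
    | _, _ => False
  no_deadlock
    | init => ⟨choose 0 false, rfl⟩
    | choose j b => by
      by_cases h : (j : ℕ) = k
      · exact ⟨ask 0, h⟩
      · exact ⟨choose ⟨j + 1, by omega⟩ false, rfl⟩
    | ask j => ⟨reply j false, rfl⟩
    | reply _ _ => ⟨init, trivial⟩

/-- Dimension `(j, b)`: there is a request at the start of each round; it is answered when the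
`j`-th bit is chosen to be different from `b`, and by each reply different from `(j, b)`. -/
def recallPriority (k : ℕ) (a : Fin (k + 1) × Bool) : RecallVertex k → ℕ
  | init => 1
  | choose j b => if j = a.1 ∧ b ≠ a.2 then 0 else 2
  | ask _ => 2
  | reply j b => if j = a.1 ∧ b = a.2 then 2 else 0

variable {k : ℕ}

theorem recallPriority_le (a : Fin (k + 1) × Bool) (v : RecallVertex k) :
    recallPriority k a v ≤ 2 := by
  cases v <;> simp only [recallPriority] <;> (try split_ifs) <;> omega

theorem eq_init_of_recallPriority {a : Fin (k + 1) × Bool} {v : RecallVertex k}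
    (h : recallPriority k a v = 1) : v = init := by
  cases v with
  | init => rfl
  | choose j b => simp only [recallPriority] at h; split_ifs at h; omega
  | ask j => simp [recallPriority] at h
  | reply j b => simp only [recallPriority] at h; split_ifs at h; omega

/-- The shape of a round. -/
theorem recallGame_round {π : ℕ → RecallVertex k} (hπ : π ∈ (recallGame k).plays) {t : ℕ}
    (ht : π t = init) : ∃ (x : Fin (k + 1) → Bool) (j : Fin (k + 1)) (b : Bool),
      (∀ q : Fin (k + 1), π (t + 1 + q) = choose q (x q)) ∧ π (t + k + 2) = ask j ∧
        π (t + k + 3) = reply j b := by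
  have h1 : ∀ q, ∀ h : q < k + 1, ∃ b, π (t + 1 + q) = choose ⟨q, h⟩ b := by
    intro q
    induction q with
    | zero =>
      intro h
      have he := hπ t
      rw [ht] at he
      rw [add_zero]
      cases hv : π (t + 1) <;> rw [hv] at he <;> simp only [recallGame] at he
      exact ⟨_, congrArg₂ _ (Fin.ext he) rfl⟩
    | succ q ih =>
      intro h
      obtain ⟨b, hb⟩ := ih (by omega)
      have he := hπ (t + 1 + q)
      rw [hb] at he
      rw [← add_assoc]
      cases hv : π (t + 1 + q + 1) <;> rw [hv] at he <;> simp only [recallGame] at he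
      · exact ⟨_, congrArg₂ _ (Fin.ext he) rfl⟩
      · omega
  choose x hx using h1
  have hask : ∃ j, π (t + k + 2) = ask j := by
    have he := hπ (t + 1 + k)
    rw [hx k (by omega)] at he
    rw [show t + k + 2 = t + 1 + k + 1 by omega]
    cases hv : π (t + 1 + k + 1) with
    | init => rw [hv] at he; simp only [recallGame] at he
    | choose j b =>
      rw [hv] at he
      simp only [recallGame] at he
      omega
    | ask j => exact ⟨j, rfl⟩
    | reply j b => rw [hv] at he; simp only [recallGame] at he
  obtain ⟨j, hj⟩ := hask
  have hreply : ∃ b, π (t + k + 3) = reply j b := by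
    have he := hπ (t + k + 2)
    rw [hj] at he
    rw [show t + k + 3 = t + k + 2 + 1 by omega]
    cases hv : π (t + k + 2 + 1) <;> rw [hv] at he <;> simp only [recallGame] at he
    exact ⟨_, congrArg₂ _ he rfl⟩
  obtain ⟨b, hb⟩ := hreply
  exact ⟨fun q => x q q.2, j, b, fun q => hx q q.2, hj, hb⟩

/-- Store the bits chosen by player one. -/
def recallUpdate (m : Fin (k + 1) → Bool) : RecallVertex k → Fin (k + 1) → Bool
  | choose j b => Function.update m j b
  | _ => m

/-- Reply with the stored bit; leave the reply vertex if `leave` holds. -/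
def recallMove (leave : Bool) (m : Fin (k + 1) → Bool) : RecallVertex k → RecallVertex k
  | ask j => reply j (m j)
  | reply j b => if leave then init else reply j b
  | v => v

theorem recallMove_legal (leave : Bool) (m : Fin (k + 1) → Bool)
    (v : {v // (recallGame k).owner v = .two}) :
    (recallGame k).E v.1 (recallMove leave m v.1) := by
  obtain ⟨v, hv⟩ := v
  cases v with
  | init => simp [recallGame] at hv
  | choose j b => simp [recallGame] at hv
  | ask j => simp [recallGame, recallMove]
  | reply j b => cases leave <;> simp [recallGame, recallMove]

/-- The machine that stores the bits and, after its reply, waits either forever or not at all. -/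
def recallMachine (k : ℕ) (leave : Bool) :
    MooreMachine (recallGame k) .two (Fin (k + 1) → Bool) where
  init _ := false
  update := recallUpdate
  action m v := recallMove leave m v.1

/-- Reply with the stored bit, and leave the reply vertex at the times in `w`. -/
def recallStrategy (k : ℕ) (w : ℕ → Bool) : Strategy (recallGame k) .two where
  move ρ v := recallMove (w ρ.length) (ρ.foldl recallUpdate fun _ => false) v.1
  legal _ v := recallMove_legal _ _ v

theorem recallMachine_encodes (leave : Bool) :
    (recallMachine k leave).Encodes (recallStrategy k fun _ => leave) := fun _ _ => rfl

section Consistent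

variable {w : ℕ → Bool} {π : ℕ → RecallVertex k}

/-- All these strategies update the stored bits alike and differ only in when they leave, so
`recallMachine k true` can describe the memory for every `w`. -/
theorem recallStrategy_next (hc : (recallStrategy k w).Consistent π) (t : ℕ)
    (h : (recallGame k).owner (π t) = .two) :
    π (t + 1) = recallMove (w t) ((recallMachine k true).memory π t) (π t) := by
  rw [hc t h, ← MooreMachine.foldl_eq_memory]
  simp only [recallStrategy, List.length_map, List.length_range]
  rfl

/-- The dimension is `(j, x j)`, where `j` is the stage asked for: choosing `x j` does not answer
it, the other choices concern other stages, and the correct reply is the only reply that leaves it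
open. -/
theorem recallStrategy_round (hπ : π ∈ (recallGame k).plays)
    (hc : (recallStrategy k w).Consistent π) {t : ℕ} (ht : π t = init) :
    ∃ a : Fin (k + 1) × Bool, π (t + k + 3) = reply a.1 a.2 ∧
      ∀ l ≤ k + 3, recallPriority k a (π (t + l)) ≠ 0 := by
  obtain ⟨x, j, b, hx, hj, hb⟩ := recallGame_round hπ ht
  -- The choices made after stage `j` change other coordinates only.
  have hmem : ∀ i, j + 1 + i ≤ k + 1 →
      (recallMachine k true).memory π (t + 1 + (j + 1 + i)) j = x j := by
    intro i
    induction i with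
    | zero =>
      intro _
      rw [show t + 1 + ((j : ℕ) + 1 + 0) = t + 1 + j + 1 by omega, MooreMachine.memory, hx j]
      simp [recallMachine, recallUpdate]
    | succ i ih =>
      intro hi
      rw [show t + 1 + ((j : ℕ) + 1 + (i + 1)) = t + 1 + (j + 1 + i) + 1 by omega,
        MooreMachine.memory, hx ⟨j + 1 + i, by omega⟩]
      have hne : j ≠ ⟨j + 1 + i, by omega⟩ := fun h => by
        have := congrArg Fin.val h
        simp only at this
        omega
      have := ih (by omega)
      simp only [recallMachine, recallUpdate] at this ⊢
      rw [Function.update_of_ne hne]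
      exact this
  have hm := hmem (k - j) (by omega)
  rw [show t + 1 + ((j : ℕ) + 1 + (k - j)) = t + k + 2 by omega] at hm
  have hr := recallStrategy_next hc (t + k + 2) (by rw [hj]; rfl)
  rw [hj, recallMove, hm] at hr
  refine ⟨(j, x j), hr, fun l hl => ?_⟩
  rcases Nat.eq_zero_or_pos l with rfl | hpos
  · rw [add_zero, ht]
    simp [recallPriority]
  rcases Nat.lt_or_ge l (k + 2) with hlt | hge
  · have := hx ⟨l - 1, by omega⟩
    simp only at this
    rw [show t + 1 + (l - 1) = t + l by omega] at this
    rw [this]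
    simp only [recallPriority]
    rw [if_neg]
    · omega
    · rintro ⟨h1, h2⟩
      exact h2 (by rw [h1])
  · rcases (show l = k + 2 ∨ l = k + 3 by omega) with rfl | rfl
    · rw [← add_assoc, hj]
      simp [recallPriority]
    · rw [show t + (k + 3) = t + k + 2 + 1 by omega, hr]
      simp [recallPriority]

theorem recallStrategy_wait (hc : (recallStrategy k w).Consistent π)
    {s i : ℕ} {j : Fin (k + 1)} {b : Bool} (hs : π s = reply j b)
    (h : ∀ u, s ≤ u → u < s + i → w u = false) : π (s + i) = reply j b := by
  induction i with
  | zero => exact hs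
  | succ i ih =>
    have hi := ih fun u h1 h2 => h u h1 (by omega)
    rw [← add_assoc, recallStrategy_next hc _ (by rw [hi]; rfl), h _ (by omega) (by omega), hi]
    rfl

theorem recallStrategy_leave (hc : (recallStrategy k w).Consistent π)
    {s : ℕ} {j : Fin (k + 1)} {b : Bool} (hs : π s = reply j b) (h : w s = true) :
    π (s + 1) = init := by
  rw [recallStrategy_next hc _ (by rw [hs]; rfl), h, hs]
  rfl

end Consistent

/-- Player two wins for the fixed types by never waiting. -/
theorem recallStrategy_isWinning_fixed {X : ObjectiveType} (hX : X.IsFixed) {n : ℕ}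
    (e : Fin n ≃ Fin (k + 1) × Bool) : (recallStrategy k fun _ => true).IsWinning
      ((recallGame k).multiObjective X (k + 4) fun m => recallPriority k (e m)) init := by
  rw [Strategy.isWinning_two_iff]
  intro π hπ h0 hc
  rw [mem_multiObjective e]
  refine not_forall_mem_fixed hX fun n => ?_
  have hinit : ∃ t ≥ n, π t = init := by
    induction n with
    | zero => exact ⟨0, le_rfl, h0⟩
    | succ n ih =>
      obtain ⟨t, ht, hi⟩ := ih
      obtain ⟨a, ha, -⟩ := recallStrategy_round hπ hc hi
      exact ⟨t + k + 3 + 1, by omega, recallStrategy_leave hc ha rfl⟩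
  obtain ⟨t, ht, hi⟩ := hinit
  obtain ⟨a, -, ha⟩ := recallStrategy_round hπ hc hi
  exact ⟨a, t, ht, by rw [hi]; rfl, fun l hl => ha l (by omega)⟩

/-- Player two wins for the direct bounded types by waiting forever. -/
theorem recallStrategy_isWinning_dirBnd {X : ObjectiveType}
    (hX : X = .DirBndPR ∨ X = .DirBndWP) {lam n : ℕ} (e : Fin n ≃ Fin (k + 1) × Bool) :
    (recallStrategy k fun _ => false).IsWinning
      ((recallGame k).multiObjective X lam fun m => recallPriority k (e m)) init := by
  rw [Strategy.isWinning_two_iff]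
  intro π hπ h0 hc
  rw [mem_multiObjective e]
  intro hm
  obtain ⟨a, hr, ha⟩ := recallStrategy_round hπ hc h0
  -- The request at time `0` stays open during the round, and afterwards the play remains at the
  -- reply `a`, which has priority 2 in dimension `a`.
  obtain ⟨l, hl⟩ := answered_of_mem_dirBnd hX (hm a) 0 (by rw [h0]; rfl)
  rcases Nat.lt_or_ge (k + 3) l with hlt | hge
  · have := recallStrategy_wait hc hr (i := l - (k + 3)) fun _ _ _ => rfl
    rw [show 0 + k + 3 + (l - (k + 3)) = 0 + l by omega] at this
    rw [this] at hl
    simp [recallPriority] at hl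
  · exact ha l hge hl

open Classical in
/-- Player two wins for all the types by waiting longer and longer. -/
theorem recallStrategy_isWinning_patient (X : ObjectiveType) {lam n : ℕ}
    (e : Fin n ≃ Fin (k + 1) × Bool) :
    (recallStrategy k fun t => decide (IsLeaveTime (k + 4) t)).IsWinning
      ((recallGame k).multiObjective X lam fun m => recallPriority k (e m)) init := by
  rw [Strategy.isWinning_two_iff]
  intro π hπ h0 hc
  rw [mem_multiObjective e]
  -- Leaving at `T = (k + 4) * 2 ^ c` opens a round whose reply comes at `T + k + 4 ≤ 2 * T`;
  -- waiting there until `2 * T` keeps a request open for `T` steps.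
  have round : ∀ c (a : Fin (k + 1) × Bool), π ((k + 4) * 2 ^ c) = reply a.1 a.2 →
      ∃ a' : Fin (k + 1) × Bool, π ((k + 4) * 2 ^ c + 1) = init ∧
        (∀ l < (k + 4) * 2 ^ c, recallPriority k a' (π ((k + 4) * 2 ^ c + 1 + l)) ≠ 0) ∧
        π ((k + 4) * 2 ^ (c + 1)) = reply a'.1 a'.2 := by
    intro c a h
    have hl : IsLeaveTime (k + 4) ((k + 4) * 2 ^ c) := ⟨c, rfl⟩
    have hK : k + 4 ≤ (k + 4) * 2 ^ c := Nat.le_mul_of_pos_right _ (Nat.two_pow_pos c)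
    have hno := fun u => not_isLeaveTime (K := k + 4) (a := c) (t := u)
    rw [pow_succ, ← mul_assoc] at hno ⊢
    generalize (k + 4) * 2 ^ c = T at *
    have hi := recallStrategy_leave hc h (by simpa using hl)
    obtain ⟨a', hr, ha'⟩ := recallStrategy_round hπ hc hi
    have hw : ∀ l < T, k + 3 ≤ l → π (T + 1 + l) = reply a'.1 a'.2 := by
      intro l hl hl'
      have := recallStrategy_wait hc hr (i := l - (k + 3)) fun u h1 h2 => by
        simpa using hno u (by omega) (by omega)
      rwa [show T + 1 + k + 3 + (l - (k + 3)) = T + 1 + l by omega] at this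
    refine ⟨a', hi, fun l hl => ?_, ?_⟩
    · rcases Nat.lt_or_ge l (k + 3) with hlt | hge
      · exact ha' l hlt.le
      · rw [hw l hl hge]
        simp [recallPriority]
    · have := hw (T - 1) (by omega) (by omega)
      rwa [show T + 1 + (T - 1) = T * 2 by omega] at this
  have start : ∀ c, ∃ a : Fin (k + 1) × Bool, π ((k + 4) * 2 ^ c) = reply a.1 a.2 := by
    intro c
    induction c with
    | zero =>
      obtain ⟨a, hr, -⟩ := recallStrategy_round hπ hc h0
      have := recallStrategy_wait hc hr (i := 1) fun u _ h => by
        simpa using not_isLeaveTime_of_lt (K := k + 4) (t := u) (by omega)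
      refine ⟨a, ?_⟩
      -- The first reply comes at time `k + 3`, one step before the first leave time.
      rw [show (k + 4) * 2 ^ 0 = 0 + k + 3 + 1 by omega]
      exact this
    | succ c ih =>
      obtain ⟨a, ha⟩ := ih
      obtain ⟨a', -, -, h⟩ := round c a ha
      exact ⟨a', h⟩
  refine not_forall_mem_objective fun n => ?_
  obtain ⟨a, ha⟩ := start n
  obtain ⟨a', hi, hun, -⟩ := round n a ha
  have hn : n < 2 ^ n := Nat.lt_two_pow_self
  have hT : n ≤ (k + 4) * 2 ^ n := by nlinarith
  exact ⟨a', _, by omega, by rw [hi]; rfl, fun l hl => hun l (by omega)⟩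

variable {M : Type*} {A : MooreMachine (recallGame k) .two M}

/-- The choices of player one for the bits `x`. -/
def choosePath (x : Fin (k + 1) → Bool) (q : ℕ) : RecallVertex k :=
  choose (Fin.ofNat (k + 1) q) (x (Fin.ofNat (k + 1) q))

/-- From every memory state, a small machine fails to recall some bit of some bit string. -/
theorem exists_not_recalled [Fintype M] (hM : Fintype.card M < 2 ^ (k + 1)) (m : M) :
    ∃ y : (Fin (k + 1) → Bool) × Fin (k + 1),
      A.action (A.read m (choosePath y.1) (k + 1)) ⟨ask y.2, rfl⟩ ≠ reply y.2 (y.1 y.2) := by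
  obtain ⟨x, y, j, hF, hj⟩ := exists_collision hM fun x => A.read m (choosePath x) (k + 1)
  -- With equal memory the machine gives the same reply to both strings, so it errs on at least one
  -- of them.
  by_cases hx : A.action (A.read m (choosePath x) (k + 1)) ⟨ask j, rfl⟩ = reply j (x j)
  · refine ⟨(y, j), fun hy => hj ?_⟩
    have hF' : A.read m (choosePath x) (k + 1) = A.read m (choosePath y) (k + 1) := hF
    simp only [← hF', hx, reply.injEq, true_and] at hy
    exact hy
  · exact ⟨(x, j), hx⟩

/-- The spoiler chooses bits, and asks for a bit, such that the machine fails to recall it. -/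
def recallSpoiler (A : MooreMachine (recallGame k) .two M)
    (bad : M → (Fin (k + 1) → Bool) × Fin (k + 1)) (_ : ℕ) (m : M) (v : RecallVertex k)
    (y : (Fin (k + 1) → Bool) × Fin (k + 1)) :
    RecallVertex k × ((Fin (k + 1) → Bool) × Fin (k + 1)) :=
  match v with
  | init => (choosePath (bad (A.update m init)).1 0, bad (A.update m init))
  | choose j _ => (if (j : ℕ) = k then ask y.2 else choosePath y.1 (j + 1), y)
  -- A dummy value: these vertices belong to player two.
  | v => (v, y)

theorem recallSpoiler_legal (bad : M → (Fin (k + 1) → Bool) × Fin (k + 1)) (t : ℕ) (m : M)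
    (v : RecallVertex k) (y : (Fin (k + 1) → Bool) × Fin (k + 1))
    (h : (recallGame k).owner v ≠ .two) :
    (recallGame k).E v (recallSpoiler A bad t m v y).1 := by
  cases v with
  | init => exact Nat.zero_mod _
  | choose j b =>
    simp only [recallSpoiler]
    split_ifs with hj
    · exact hj
    · exact Nat.mod_eq_of_lt (by omega)
  | ask j => exact absurd rfl h
  | reply j b => exact absurd rfl h

/-- Against a small machine, player one can have all requests answered within the round. -/
theorem exists_answered_of_small [Fintype M] (hM : Fintype.card M < 2 ^ (k + 1))
    {σ : Strategy (recallGame k) .two} (hA : A.Encodes σ) :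
    ∃ π ∈ (recallGame k).plays, π 0 = init ∧ σ.Consistent π ∧
      ∀ a t, recallPriority k a (π t) = 1 →
        ∃ l < k + 4, recallPriority k a (π (t + l)) = 0 := by
  choose bad hbad using exists_not_recalled (A := A) hM
  let y₀ : (Fin (k + 1) → Bool) × Fin (k + 1) := (fun _ => false, 0)
  let d := recallSpoiler A bad
  obtain ⟨hπ, hc⟩ := hA.spoilPlay_mem d init y₀
    (fun t m v y h => recallSpoiler_legal bad t m v y h)
  have hsucc := A.spoilPlay_succ_of_ne d init y₀
  have hdata := A.spoilData_succ d init y₀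
  have hzero : A.spoilPlay d init y₀ 0 = init := rfl
  generalize A.spoilPlay d init y₀ = π at *
  generalize A.spoilData d init y₀ = D at *
  refine ⟨π, hπ, hzero, hc, fun a t ht => ?_⟩
  have hi := eq_init_of_recallPriority ht
  have hround : ∀ q ≤ k, π (t + 1 + q) = choosePath (bad (A.memory π (t + 1))).1 q ∧
      D (t + 1 + q) = bad (A.memory π (t + 1)) := by
    intro q
    induction q with
    | zero =>
      intro _
      rw [add_zero, hsucc _ (by rw [hi]; simp [recallGame]), hdata, MooreMachine.memory, hi]
      exact ⟨rfl, rfl⟩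
    | succ q ih =>
      intro hq
      obtain ⟨h1, h2⟩ := ih (by omega)
      rw [← add_assoc, hsucc _ (by rw [h1]; simp [recallGame, choosePath]), hdata, h1, h2]
      simp only [d, recallSpoiler, choosePath, Fin.val_ofNat,
        Nat.mod_eq_of_lt (show q < k + 1 by omega), show q ≠ k by omega, if_false, and_self]
  have hne := hbad (A.memory π (t + 1))
  have hmem : A.memory π (t + 1 + (k + 1)) = A.read (A.memory π (t + 1))
      (choosePath (bad (A.memory π (t + 1))).1) (k + 1) := by
    rw [A.memory_add]
    exact A.read_congr _ fun q hq => (hround q (by omega)).1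
  generalize bad (A.memory π (t + 1)) = y at *
  have hask : π (t + 1 + (k + 1)) = ask y.2 := by
    obtain ⟨h1, h2⟩ := hround k le_rfl
    rw [← add_assoc, hsucc _ (by rw [h1]; simp [recallGame, choosePath]), h1, h2]
    simp only [d, recallSpoiler, choosePath, Fin.val_ofNat,
      Nat.mod_eq_of_lt (Nat.lt_succ_self k), if_true]
  have hact : π (t + k + 3) ≠ reply y.2 (y.1 y.2) := by
    have h2 := hA.consistent_iff.1 hc (t + 1 + (k + 1)) (by rw [hask]; rfl)
    simp only [hask, hmem] at h2
    rw [show t + k + 3 = t + 1 + (k + 1) + 1 by omega, h2]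
    exact hne
  obtain ⟨x, j, b, hx, hj, hb⟩ := recallGame_round hπ hi
  rw [show t + 1 + (k + 1) = t + k + 2 by omega, hj] at hask
  obtain rfl : j = y.2 := ask.inj hask
  rw [hb] at hact
  -- A dimension that agrees with the chosen bits is answered by the reply, since the reply is
  -- wrong; any other dimension is answered by the choice at its own stage.
  by_cases h : x a.1 = a.2
  · refine ⟨k + 3, by omega, ?_⟩
    rw [← add_assoc, hb]
    simp only [recallPriority]
    rw [if_neg]
    rintro ⟨h1, h2⟩
    have hxy := (hround y.2 (by omega)).1
    rw [hx y.2] at hxy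
    simp only [choosePath, choose.injEq, Fin.ofNat_eq_cast, Fin.cast_val_eq_self, true_and] at hxy
    exact hact (by rw [h2, ← h, ← h1, hxy])
  · refine ⟨1 + a.1, by omega, ?_⟩
    rw [← add_assoc, hx a.1]
    simp [recallPriority, h]

/-- A winning strategy of player two with finite memory has at least `2 ^ (k + 1)` states. -/
theorem recallGame_memory_lower_bound {X : ObjectiveType} {n : ℕ}
    (e : Fin n ≃ Fin (k + 1) × Bool) {s : ℕ} (h : (recallGame k).WinsWithMemory .two
      ((recallGame k).multiObjective X (k + 4) fun m => recallPriority k (e m)) init s) :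
    2 ^ (k + 1) ≤ s := by
  obtain ⟨M, _, A, σ, rfl, hA, hσ⟩ := h
  by_contra! hM
  obtain ⟨π, hπ, h0, hc, hans⟩ := exists_answered_of_small hM hA
  refine Strategy.isWinning_two_iff.1 hσ π hπ h0 hc ((mem_multiObjective e).2 fun a => ?_)
  exact mem_objective_of_answered (recallPriority_le a) (by omega) hπ (hans a) X

end RecallGame

end WindowParity

/-! ### Choice of parameters and assembly. -/

open WindowParity in
theorem lemma6 (i : Player) :
    ∃ C : ℕ, ∀ k : ℕ,
      ∃ (V : Type) (_ : Fintype V) (G : GameStructure V) (v₀ : V)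
        (n : ℕ) (p : Fin n → V → ℕ) (lam : ℕ),
        Fintype.card V ≤ C * (k + 1) ∧
        (1 ≤ n ∧ n ≤ C * (k + 1)) ∧
        (1 ≤ lam ∧ lam ≤ C * (k + 1)) ∧
        (∀ m v, p m v ≤ 2) ∧
        ∀ X : ObjectiveType,
          G.Wins i (G.multiObjective X lam p) v₀ ∧
          (i = .one ∨ (X ≠ .BndPR ∧ X ≠ .BndWP) →
            ∃ s, G.WinsWithMemory i (G.multiObjective X lam p) v₀ s) ∧
          ∀ s, G.WinsWithMemory i (G.multiObjective X lam p) v₀ s → 2 ^ k ≤ s := by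
  -- The largest demand is the `4 * k + 8` vertices of `echoGame (k + 1)`, which at `k = 0` requires
  -- 8.
  refine ⟨8, fun k => ?_⟩
  -- Both games use `k + 1` bits, so that there is a dimension even for `k = 0`; their bound `2 ^ (k
  -- + 1)` is more than needed.
  have hpow : 2 ^ k ≤ 2 ^ (k + 1) := Nat.pow_le_pow_right (by norm_num) (Nat.le_succ k)
  have hcard : Fintype.card (Fin (k + 1) × Bool) = (k + 1) * 2 := by simp
  let e : Fin ((k + 1) * 2) ≃ Fin (k + 1) × Bool := (Fintype.equivFinOfCardEq hcard).symm
  cases i with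
  | one =>
    refine ⟨_, inferInstance, echoGame (k + 1), node (k + 1) 0 false, _,
      fun m => echoPriority (k + 1) (e m), k + 1 + 2, ?_, ⟨by omega, by omega⟩,
      ⟨by omega, by omega⟩, fun m v => echoPriority_le _ _ v, fun X => ?_⟩
    · rw [Fintype.card_prod, Fintype.card_fin, Fintype.card_bool]
      omega
    · have hw := echoStrategy_isWinning X e
      exact ⟨⟨_, hw⟩, fun _ => ⟨_, _, inferInstance, echoMachine (k + 1), _, rfl,
        MooreMachine.encodes_toStrategy _ echoMachine_legal, hw⟩,
        fun s hs => hpow.trans (echoGame_memory_lower_bound e hs)⟩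
  | two =>
    refine ⟨_, inferInstance, recallGame k, .init, _,
      fun m => recallPriority k (e m), k + 4, ?_, ⟨by omega, by omega⟩,
      ⟨by omega, by omega⟩, fun m v => recallPriority_le _ v, fun X => ?_⟩
    · exact RecallVertex.card_le.trans (by omega)
    · refine ⟨⟨_, recallStrategy_isWinning_patient X e⟩, fun hX => ?_,
        fun s hs => hpow.trans (recallGame_memory_lower_bound e hs)⟩
      have hsplit : X.IsFixed ∨ (X = .DirBndPR ∨ X = .DirBndWP) := by
        rcases hX with h | ⟨h1, h2⟩
        · cases h
        · cases X <;> simp_all [ObjectiveType.IsFixed]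
      rcases hsplit with hX | hX
      · exact ⟨_, _, inferInstance, recallMachine k true, _, rfl, recallMachine_encodes true,
          recallStrategy_isWinning_fixed hX e⟩
      · exact ⟨_, _, inferInstance, recallMachine k false, _, rfl, recallMachine_encodes false,
          recallStrategy_isWinning_dirBnd hX e⟩
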